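/- Let $K$ be a field and let $q\in K$ satisfy $q^k\neq 1$ for every integer $k\ge 1$ (for instance, $q$ an indeterminate and $K=F(q)$ the field of rational functions over a field $F$, or $q\in\mathbb{C}$ with $|q|<1$). For $a, x\in K$ and an integer $n\ge 0$ put $(a;x)_n:=\prod_{i=0}^{n-1}(1-ax^i)$, and use the convention $1/(x;x)_n:=0$ for integers $n<0$. For integers $N,k$ let $${N\brack k}_x:=\frac{(x;x)_N}{(x;x)_k(x;x)_{N-k}}\quad\text{if } k\ge 0 \text{ and } N-k\ge 0,\qquad {N\brack k}_x:=0\quad\text{otherwise.}$$ Let $Q(m,n):=2m^2+6mn+6n^2$. Then for every integer $M\ge 0$, $$\sum_{m,n\ge 0}\frac{q^{Q(m,n)}\,(q^3;q^3)_M}{(q;q)_m\,(q^3;q^3)_n\,(q^3;q^3)_{M-2n-m}}=\sum_{j=-M}^{M}q^{3j^2+j}{2M\brack M+j}_{q^3},$$ where only finitely many terms of the sum on the left are nonzero. -/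

import Mathlib

namespace FinCap

variable {K : Type*} [Field K]

/-- The `q`-Pochhammer symbol `(a; q)_n = (1 - a)(1 - a q) ⋯ (1 - a q^(n-1))`, for `n ≥ 0`. -/
def qPoch (a q : K) (n : ℕ) : K := ∏ i ∈ Finset.range n, (1 - a * q ^ i)

/-- The reciprocal `1 / (q; q)_n` for an integer `n`, equal to `0` if `n < 0`. -/
def qPochRecip (q : K) (n : ℤ) : K :=
  if 0 ≤ n then 1 / qPoch q q n.toNat else 0

/-- The `q`-binomial coefficient `[N, k]_q = (q; q)_N / ((q; q)_k (q; q)_(N-k))` if `k ≥ 0` and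
`N - k ≥ 0`, and `0` otherwise. -/
def qBinom (q : K) (N k : ℤ) : K :=
  if 0 ≤ k ∧ 0 ≤ N - k then
    qPoch q q N.toNat / (qPoch q q k.toNat * qPoch q q (N - k).toNat)
  else 0

/-- The quadratic form `Q(m, n) = 2 m² + 6 m n + 6 n²`. -/
def Q (m n : ℕ) : ℕ := 2 * m ^ 2 + 6 * m * n + 6 * n ^ 2

/-- The summand `q^Q(m,n) (q³; q³)_M / ((q; q)_m (q³; q³)_n (q³; q³)_(M-2n-m))`, where
`M - 2n - m` is an integer that may be negative. -/
def summand (q : K) (M m n : ℕ) : K :=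
  q ^ Q m n * qPoch (q ^ 3) (q ^ 3) M *
    (qPochRecip q m * qPochRecip (q ^ 3) n *
      qPochRecip (q ^ 3) ((M : ℤ) - 2 * (n : ℤ) - (m : ℤ)))

end FinCap

namespace FinCap

variable {K : Type*} [Field K]

open Finset

/-! Write p = q³. Separating exponents mod 3 in (-t;q)_∞ expands 1/(q;q)_m as a sum over l + b + c =
m of terms in base p (`sum_cubicTerm`). After replacing b, c by b - n, c - n, the index n survives
only in a limiting q-Chu–Vandermonde sum and disappears. With u = b + l, v = c + l, the full
q-Chu–Vandermonde sum removes l. Finally, for fixed j = u - v, the same summation removes v and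
leaves the q-binomial. Negative powers of q occur throughout, so q = 0 is treated apart. -/

/-! ### Reindexing sums over boxes -/

/-- The finite sets need not correspond under `e`; each only has to contain the support, so both
sums equal a `finsum`. -/
theorem sum_comp_equiv_of_support {ι : Type*} (s t : Finset ι) (e : ι ≃ ι) (g : ι → K)
    (hs : ∀ x, g x ≠ 0 → x ∈ s) (ht : ∀ x, g (e x) ≠ 0 → x ∈ t) :
    ∑ x ∈ t, g (e x) = ∑ x ∈ s, g x := by
  rw [← finsum_eq_sum_of_support_subset g (s := s) (fun x hx => by simpa using hs x hx),
    ← finsum_eq_sum_of_support_subset (fun x => g (e x)) (s := t)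
      (fun x hx => by simpa using ht x hx)]
  exact finsum_comp_equiv e

theorem sum_add_of_support (s t : Finset ℤ) (a : ℤ) (g : ℤ → K)
    (hs : ∀ x, g x ≠ 0 → x ∈ s ∧ x - a ∈ t) :
    ∑ x ∈ t, g (x + a) = ∑ x ∈ s, g x :=
  sum_comp_equiv_of_support s t (Equiv.addRight a) g (fun x hx => (hs x hx).1)
    (fun x hx => by simpa using (hs _ hx).2)

theorem sum_sub_left_of_support (s t : Finset ℤ) (a : ℤ) (g : ℤ → K)
    (hs : ∀ x, g x ≠ 0 → x ∈ s ∧ a - x ∈ t) :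
    ∑ x ∈ t, g (a - x) = ∑ x ∈ s, g x :=
  sum_comp_equiv_of_support s t (Equiv.subLeft a) g (fun x hx => (hs x hx).1)
    (fun x hx => by simpa using (hs _ hx).2)

/-! ### Pochhammer symbols and their reciprocals -/

theorem qPoch_succ (a q : K) (n : ℕ) : qPoch a q (n + 1) = qPoch a q n * (1 - a * q ^ n) :=
  Finset.prod_range_succ _ _

theorem qPoch_ne_zero {q : K} (hq : ∀ k : ℕ, 0 < k → q ^ k ≠ 1) (n : ℕ) : qPoch q q n ≠ 0 := by
  refine Finset.prod_ne_zero_iff.2 fun i _ => ?_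
  rw [← pow_succ', sub_ne_zero]
  exact (hq _ i.succ_pos).symm

theorem qPochRecip_of_neg (q : K) {n : ℤ} (hn : n < 0) : qPochRecip q n = 0 := by
  simp [qPochRecip, hn]

theorem nonneg_of_qPochRecip_ne_zero {q : K} {n : ℤ} (h : qPochRecip q n ≠ 0) : 0 ≤ n := by
  by_contra! hn
  exact h (qPochRecip_of_neg q hn)

theorem qPochRecip_zero (q : K) : qPochRecip q 0 = 1 := by
  simp [qPochRecip, qPoch]

theorem qPochRecip_natCast (q : K) (n : ℕ) : qPochRecip q n = (qPoch q q n)⁻¹ := by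
  simp [qPochRecip]

/-- The zero convention makes this hold for every integer (at n = 0 both sides vanish), so the
recurrences below need no boundary cases. -/
theorem qPochRecip_sub_one {q : K} (hq : ∀ k : ℕ, 0 < k → q ^ k ≠ 1) (n : ℤ) :
    qPochRecip q (n - 1) = (1 - q ^ n) * qPochRecip q n := by
  rcases lt_trichotomy n 0 with hn | rfl | hn
  · rw [qPochRecip_of_neg q hn, qPochRecip_of_neg q (by lia), mul_zero]
  · rw [qPochRecip_of_neg q (by lia)]; simp
  · obtain ⟨k, rfl⟩ : ∃ k : ℕ, n = (k : ℤ) + 1 := ⟨(n - 1).toNat, by lia⟩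
    have h := qPoch_ne_zero hq (k + 1)
    rw [add_sub_cancel_right, qPochRecip_natCast, ← Nat.cast_succ, qPochRecip_natCast,
      zpow_natCast]
    rw [Nat.succ_eq_add_one, qPoch_succ, ← pow_succ'] at *
    have h1 := left_ne_zero_of_mul h
    have h2 := right_ne_zero_of_mul h
    field_simp

theorem one_sub_zpow_ne_zero {q : K} (hq : ∀ k : ℕ, 0 < k → q ^ k ≠ 1) {n : ℤ} (hn : 0 < n) :
    1 - q ^ n ≠ 0 := by
  lift n to ℕ using hn.le
  rw [zpow_natCast, sub_ne_zero]
  exact (hq n (by lia)).symm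

/-! ### q-Chu–Vandermonde summations -/

/-- The limiting case of the `q`-Chu–Vandermonde summation. -/
theorem sum_zpow_mul_qPochRecip_three {q : K} (hq0 : q ≠ 0) (hq : ∀ k : ℕ, 0 < k → q ^ k ≠ 1)
    (M : ℤ) (b : ℕ) (hb : (b : ℤ) ≤ M) (c : ℤ) :
    ∑ n ∈ Icc 0 M, q ^ ((b - n) * (c - n)) *
      (qPochRecip q n * qPochRecip q (b - n) * qPochRecip q (c - n)) =
    qPochRecip q b * qPochRecip q c := by
  induction b generalizing c with
  | zero =>
    rw [Finset.sum_eq_single 0]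
    · simp [qPochRecip_zero]
    · intro n hn hn0
      rw [mem_Icc] at hn
      rw [qPochRecip_of_neg q (n := ((0 : ℕ) : ℤ) - n) (by lia)]
      simp
    · intro h
      exact absurd (mem_Icc.2 ⟨le_rfl, by simpa using hb⟩) h
  | succ b ih =>
    push_cast at *
    refine mul_left_cancel₀ (one_sub_zpow_ne_zero hq (n := (b : ℤ) + 1) (by lia)) ?_
    -- Split 1 - q^(b+1) = q^n (1 - q^(b+1-n)) + (1 - q^n). The first part lowers b; the second,
    -- after n ↦ n + 1, lowers both b and c.
    have key : ∀ n : ℤ, (1 - q ^ ((b : ℤ) + 1)) * (q ^ ((b + 1 - n) * (c - n)) *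
        (qPochRecip q n * qPochRecip q (b + 1 - n) * qPochRecip q (c - n))) =
        q ^ c * (q ^ ((b - n) * (c - n)) *
          (qPochRecip q n * qPochRecip q (b - n) * qPochRecip q (c - n))) +
        q ^ ((b + 1 - n) * (c - n)) *
          (qPochRecip q (n - 1) * qPochRecip q (b + 1 - n) * qPochRecip q (c - n)) := by
      intro n
      have h1 : qPochRecip q (b - n) = (1 - q ^ (b + 1 - n)) * qPochRecip q (b + 1 - n) := by
        rw [← qPochRecip_sub_one hq]; congr 1; ring
      have h2 : q ^ c * q ^ ((b - n) * (c - n)) = q ^ n * q ^ ((b + 1 - n) * (c - n)) := by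
        rw [← zpow_add₀ hq0, ← zpow_add₀ hq0]; congr 1; ring
      have h3 : q ^ ((b : ℤ) + 1) = q ^ n * q ^ (b + 1 - n) := by
        rw [← zpow_add₀ hq0]; congr 1; ring
      rw [h1, qPochRecip_sub_one hq, ← mul_assoc (q ^ c), h2, h3]
      ring
    rw [mul_sum, sum_congr rfl fun n _ => key n, sum_add_distrib, ← mul_sum, ih (by lia)]
    have shift : ∑ n ∈ Icc 0 M, q ^ ((b + 1 - n) * (c - n)) *
          (qPochRecip q (n - 1) * qPochRecip q (b + 1 - n) * qPochRecip q (c - n)) =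
        qPochRecip q b * qPochRecip q (c - 1) := by
      rw [← ih (by lia), ← sum_add_of_support (Icc 0 M) (Icc 0 M) 1]
      · refine sum_congr rfl fun n _ => ?_
        rw [show (b : ℤ) + 1 - (n + 1) = b - n by ring, show c - (n + 1) = c - 1 - n by ring,
          add_sub_cancel_right]
      · intro n hn
        have h1 := nonneg_of_qPochRecip_ne_zero (left_ne_zero_of_mul
          (left_ne_zero_of_mul (right_ne_zero_of_mul hn)))
        have h2 := nonneg_of_qPochRecip_ne_zero (right_ne_zero_of_mul
          (left_ne_zero_of_mul (right_ne_zero_of_mul hn)))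
        simp only [mem_Icc]
        lia
    have hb1 : qPochRecip q b = (1 - q ^ ((b : ℤ) + 1)) * qPochRecip q (b + 1) := by
      rw [← qPochRecip_sub_one hq]; congr 1; ring
    rw [shift, qPochRecip_sub_one hq c, hb1]
    ring

/-- The `q`-Chu–Vandermonde summation. -/
theorem sum_zpow_mul_qPochRecip_four {q : K} (hq0 : q ≠ 0) (hq : ∀ k : ℕ, 0 < k → q ^ k ≠ 1)
    (M : ℤ) (u w : ℕ) (hu : (u : ℤ) ≤ M) (v : ℤ) :
    ∑ l ∈ Icc 0 M, q ^ ((u - l) * (v - l)) *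
      (qPochRecip q l * qPochRecip q (u - l) * qPochRecip q (v - l) *
        qPochRecip q (w - v + l)) =
    qPochRecip q u * qPochRecip q w * qPoch q q (u + w) *
      (qPochRecip q v * qPochRecip q (u + w - v)) := by
  induction u generalizing v with
  | zero =>
    rw [Finset.sum_eq_single 0]
    · have := qPoch_ne_zero hq w
      simp [qPochRecip_zero, qPochRecip_natCast, this]
    · intro n hn hn0
      rw [mem_Icc] at hn
      rw [qPochRecip_of_neg q (n := ((0 : ℕ) : ℤ) - n) (by lia)]
      simp
    · intro h
      exact absurd (mem_Icc.2 ⟨le_rfl, by simpa using hu⟩) h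
  | succ u ih =>
    push_cast at *
    refine mul_left_cancel₀ (one_sub_zpow_ne_zero hq (n := (u : ℤ) + 1) (by lia)) ?_
    have key : ∀ n : ℤ, (1 - q ^ ((u : ℤ) + 1)) * (q ^ ((u + 1 - n) * (v - n)) *
        (qPochRecip q n * qPochRecip q (u + 1 - n) * qPochRecip q (v - n) *
          qPochRecip q (w - v + n))) =
        q ^ v * (q ^ ((u - n) * (v - n)) *
          (qPochRecip q n * qPochRecip q (u - n) * qPochRecip q (v - n) *
            qPochRecip q (w - v + n))) +
        q ^ ((u + 1 - n) * (v - n)) *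
          (qPochRecip q (n - 1) * qPochRecip q (u + 1 - n) * qPochRecip q (v - n) *
            qPochRecip q (w - v + n)) := by
      intro n
      have h1 : qPochRecip q (u - n) = (1 - q ^ (u + 1 - n)) * qPochRecip q (u + 1 - n) := by
        rw [← qPochRecip_sub_one hq]; congr 1; ring
      have h2 : q ^ v * q ^ ((u - n) * (v - n)) = q ^ n * q ^ ((u + 1 - n) * (v - n)) := by
        rw [← zpow_add₀ hq0, ← zpow_add₀ hq0]; congr 1; ring
      have h3 : q ^ ((u : ℤ) + 1) = q ^ n * q ^ (u + 1 - n) := by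
        rw [← zpow_add₀ hq0]; congr 1; ring
      rw [h1, qPochRecip_sub_one hq, ← mul_assoc (q ^ v), h2, h3]
      ring
    rw [mul_sum, sum_congr rfl fun n _ => key n, sum_add_distrib, ← mul_sum, ih (by lia)]
    have shift : ∑ n ∈ Icc 0 M, q ^ ((u + 1 - n) * (v - n)) *
          (qPochRecip q (n - 1) * qPochRecip q (u + 1 - n) * qPochRecip q (v - n) *
            qPochRecip q (w - v + n)) =
        qPochRecip q u * qPochRecip q w * qPoch q q (u + w) *
          (qPochRecip q (v - 1) * qPochRecip q (u + w - (v - 1))) := by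
      rw [← ih (by lia), ← sum_add_of_support (Icc 0 M) (Icc 0 M) 1]
      · refine sum_congr rfl fun n _ => ?_
        rw [show (u : ℤ) + 1 - (n + 1) = u - n by ring, show v - (n + 1) = v - 1 - n by ring,
          show (w : ℤ) - v + (n + 1) = w - (v - 1) + n by ring, add_sub_cancel_right]
      · intro n hn
        have h := left_ne_zero_of_mul (left_ne_zero_of_mul (right_ne_zero_of_mul hn))
        have h1 := nonneg_of_qPochRecip_ne_zero (left_ne_zero_of_mul h)
        have h2 := nonneg_of_qPochRecip_ne_zero (right_ne_zero_of_mul h)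
        simp only [mem_Icc]
        lia
    have hu1 : qPochRecip q u = (1 - q ^ ((u : ℤ) + 1)) * qPochRecip q (u + 1) := by
      rw [← qPochRecip_sub_one hq]; congr 1; ring
    have h4 : qPochRecip q (u + w - v) =
        (1 - q ^ ((u : ℤ) + 1 + w - v)) * qPochRecip q (u + 1 + w - v) := by
      rw [← qPochRecip_sub_one hq]; congr 1; ring
    -- The two parts recombine by q^v (1 - q^(u+1+w-v)) + (1 - q^v) = 1 - q^(u+1+w), the new
    -- Pochhammer factor.
    have h5 : qPoch q q (u + 1 + w) = qPoch q q (u + w) * (1 - q ^ v * q ^ ((u : ℤ) + 1 + w - v)) := by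
      rw [add_right_comm, qPoch_succ, ← pow_succ', ← zpow_add₀ hq0, ← zpow_natCast]
      congr 3; push_cast; ring
    rw [shift, qPochRecip_sub_one hq v, hu1, h4, h5,
      show (u : ℤ) + w - (v - 1) = u + 1 + w - v by ring]
    ring

/-! ### Cubic splitting of 1/(q;q)_m -/

theorem pow_three_pow_ne_one {q : K} (hq : ∀ k : ℕ, 0 < k → q ^ k ≠ 1) (k : ℕ) (hk : 0 < k) :
    (q ^ 3) ^ k ≠ 1 := by
  rw [← pow_mul]; exact hq _ (by lia)

/-- The summand in the cubic splitting of `1 / (q; q)_(l+b+c)`. -/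
def cubicTerm (q : K) (l b c : ℤ) : K :=
  q ^ (l ^ 2 + b ^ 2 + c ^ 2 - l * b - l * c - b * c + b - c) *
    (qPochRecip (q ^ 3) l * qPochRecip (q ^ 3) b * qPochRecip (q ^ 3) c)

theorem nonneg_of_cubicTerm_ne_zero {q : K} {l b c : ℤ} (h : cubicTerm q l b c ≠ 0) :
    0 ≤ l ∧ 0 ≤ b ∧ 0 ≤ c := by
  have h1 := right_ne_zero_of_mul h
  exact ⟨nonneg_of_qPochRecip_ne_zero (left_ne_zero_of_mul (left_ne_zero_of_mul h1)),
    nonneg_of_qPochRecip_ne_zero (right_ne_zero_of_mul (left_ne_zero_of_mul h1)),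
    nonneg_of_qPochRecip_ne_zero (right_ne_zero_of_mul h1)⟩

/-- The indices c, l, b belong to the factors (-t;q³)_∞, (-tq;q³)_∞, (-tq²;q³)_∞. The substitution t
↦ tq permutes these cyclically, up to (-tq³;q³)_∞ replacing (-t;q³)_∞, which accounts for q^(3c). -/
theorem cubicTerm_rotate {q : K} (hq0 : q ≠ 0) (l b c : ℤ) :
    q ^ (l + b + c) * cubicTerm q b c l = q ^ (3 * c) * cubicTerm q l b c := by
  unfold cubicTerm
  have h : q ^ (l + b + c) * q ^ (b ^ 2 + c ^ 2 + l ^ 2 - b * c - b * l - c * l + c - l) =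
      q ^ (3 * c) * q ^ (l ^ 2 + b ^ 2 + c ^ 2 - l * b - l * c - b * c + b - c) := by
    rw [← zpow_add₀ hq0, ← zpow_add₀ hq0]; congr 1; ring
  rw [← mul_assoc, ← mul_assoc, h]
  ring

theorem sum_cubicTerm_rotate {q : K} (hq0 : q ≠ 0) (M m : ℤ) (hm : m ≤ M) :
    ∑ b ∈ Icc 0 M, ∑ c ∈ Icc 0 M, q ^ (3 * c) * cubicTerm q (m - b - c) b c =
      q ^ m * ∑ b ∈ Icc 0 M, ∑ c ∈ Icc 0 M, cubicTerm q (m - b - c) b c := by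
  have h1 : ∀ b ∈ Icc 0 M, ∑ c ∈ Icc 0 M, q ^ (3 * c) * cubicTerm q (m - b - c) b c =
      ∑ c ∈ Icc 0 M, q ^ m * cubicTerm q b (m - c - b) c := by
    intro b hb
    rw [mem_Icc] at hb
    rw [← sum_sub_left_of_support (Icc 0 M) (Icc 0 M) (m - b)]
    · refine sum_congr rfl fun c _ => ?_
      rw [← cubicTerm_rotate hq0]
      congr 2
      · ring
      · ring
      · ring
    · intro c hc
      have := nonneg_of_cubicTerm_ne_zero (right_ne_zero_of_mul hc)
      simp only [mem_Icc]
      lia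
  have h2 : ∀ c ∈ Icc 0 M, ∑ b ∈ Icc 0 M, cubicTerm q b (m - c - b) c =
      ∑ b ∈ Icc 0 M, cubicTerm q (m - b - c) b c := by
    intro c hc
    rw [mem_Icc] at hc
    rw [← sum_sub_left_of_support (Icc 0 M) (Icc 0 M) (m - c)]
    · refine sum_congr rfl fun b _ => ?_
      congr 1 <;> ring
    · intro b hb
      have := nonneg_of_cubicTerm_ne_zero hb
      simp only [mem_Icc]
      lia
  rw [sum_congr rfl h1, sum_comm]
  simp only [← mul_sum]
  rw [sum_congr rfl h2, sum_comm]

theorem zpow_pow_three (q : K) (n : ℤ) : (q ^ 3) ^ n = q ^ (3 * n) := by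
  rw [zpow_mul]; norm_cast

/-- Splitting `(-t; q)_∞ = (-t; q³)_∞ (-tq; q³)_∞ (-tq²; q³)_∞`, compared coefficientwise. -/
theorem sum_cubicTerm {q : K} (hq0 : q ≠ 0) (hq : ∀ k : ℕ, 0 < k → q ^ k ≠ 1) (M : ℤ) (m : ℕ)
    (hm : (m : ℤ) ≤ M) :
    ∑ b ∈ Icc 0 M, ∑ c ∈ Icc 0 M, cubicTerm q (m - b - c) b c = qPochRecip q m := by
  induction m with
  | zero =>
    have hM : 0 ∈ Icc 0 M := mem_Icc.2 ⟨le_rfl, by simpa using hm⟩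
    rw [sum_eq_single_of_mem 0 hM, sum_eq_single_of_mem 0 hM]
    · simp [cubicTerm, qPochRecip_zero]
    · intro c hc hc0
      by_contra h
      have := nonneg_of_cubicTerm_ne_zero h
      push_cast at this
      lia
    · intro b hb hb0
      refine sum_eq_zero fun c hc => ?_
      by_contra h
      have := nonneg_of_cubicTerm_ne_zero h
      rw [mem_Icc] at hb
      push_cast at this
      lia
  | succ m ih =>
    push_cast at *
    have ih := ih (by lia)
    refine mul_left_cancel₀ (one_sub_zpow_ne_zero hq (n := (m : ℤ) + 1) (by lia)) ?_
    rw [← qPochRecip_sub_one hq, add_sub_cancel_right, ← ih, sub_mul, one_mul,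
      ← sum_cubicTerm_rotate hq0 M _ hm, ← sum_sub_distrib]
    -- Coefficient form of (-t;q)_∞ = (1 + t)(-tq;q)_∞: the factor 1 - q^(3c) lowers c by one, and
    -- so m + 1 to m.
    have h1 : ∀ b ∈ Icc 0 M, ∑ c ∈ Icc 0 M, cubicTerm q (m + 1 - b - c) b c -
        ∑ c ∈ Icc 0 M, q ^ (3 * c) * cubicTerm q (m + 1 - b - c) b c =
        q ^ (-m : ℤ) * ∑ c ∈ Icc 0 M, q ^ (3 * c) * cubicTerm q (m - b - c) b c := by
      intro b hb
      have h2 : ∀ c : ℤ, cubicTerm q (m + 1 - b - c) b c -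
          q ^ (3 * c) * cubicTerm q (m + 1 - b - c) b c =
          q ^ (-m : ℤ) * (q ^ (3 * (c - 1)) * cubicTerm q (m - b - (c - 1)) b (c - 1)) := by
        intro c
        unfold cubicTerm
        rw [qPochRecip_sub_one (pow_three_pow_ne_one hq), zpow_pow_three, ← mul_assoc,
          ← mul_assoc (q ^ (3 * (c - 1))), ← zpow_add₀ hq0, ← mul_assoc (q ^ (-m : ℤ)),
          ← zpow_add₀ hq0, show (m : ℤ) - b - (c - 1) = m + 1 - b - c by ring,
          show -(m : ℤ) + (3 * (c - 1) + ((m + 1 - b - c) ^ 2 + b ^ 2 + (c - 1) ^ 2 -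
            (m + 1 - b - c) * b - (m + 1 - b - c) * (c - 1) - b * (c - 1) + b - (c - 1))) =
            (m + 1 - b - c) ^ 2 + b ^ 2 + c ^ 2 -
            (m + 1 - b - c) * b - (m + 1 - b - c) * c - b * c + b - c by ring]
        ring
      rw [← sum_sub_distrib, sum_congr rfl fun c _ => h2 c, ← mul_sum]
      congr 1
      refine sum_add_of_support (Icc 0 M) (Icc 0 M) (-1)
        (fun c => q ^ (3 * c) * cubicTerm q (m - b - c) b c) fun c hc => ?_
      have := nonneg_of_cubicTerm_ne_zero (right_ne_zero_of_mul hc)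
      simp only [mem_Icc]
      lia
    rw [sum_congr rfl h1, ← mul_sum, sum_cubicTerm_rotate hq0 M _ (by lia), ← mul_assoc,
      ← zpow_add₀ hq0]
    simp

/-! ### Successive elimination of summation indices -/

theorem sum_qPochRecip_two_reduce {q : K} (hq0 : q ≠ 0) (hq : ∀ k : ℕ, 0 < k → q ^ k ≠ 1)
    (M : ℕ) :
    ∑ m ∈ Icc (0 : ℤ) M, ∑ n ∈ Icc (0 : ℤ) M, q ^ (2 * m ^ 2 + 6 * m * n + 6 * n ^ 2) *
      (qPochRecip q m * qPochRecip (q ^ 3) n * qPochRecip (q ^ 3) (M - 2 * n - m)) =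
    ∑ l ∈ Icc (0 : ℤ) M, ∑ b ∈ Icc (0 : ℤ) M, ∑ c ∈ Icc (0 : ℤ) M,
      q ^ (3 * (l ^ 2 + l * b + l * c + b ^ 2 + c ^ 2) + b - c) *
      (qPochRecip (q ^ 3) b * qPochRecip (q ^ 3) c * qPochRecip (q ^ 3) l *
        qPochRecip (q ^ 3) (M - l - b - c)) := by
  have hp0 : q ^ 3 ≠ 0 := pow_ne_zero 3 hq0
  have hp := pow_three_pow_ne_one hq
  set f : ℤ → ℤ → ℤ → ℤ → K := fun n m b c => q ^ (2 * m ^ 2 + 6 * m * n + 6 * n ^ 2) *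
      (cubicTerm q (m - b - c) b c * qPochRecip (q ^ 3) n *
        qPochRecip (q ^ 3) (M - 2 * n - m)) with hf
  have hsupp : ∀ n m b c, f n m b c ≠ 0 →
      0 ≤ n ∧ 0 ≤ m - b - c ∧ 0 ≤ b ∧ 0 ≤ c ∧ 0 ≤ M - 2 * n - m := by
    intro n m b c h
    have h1 := right_ne_zero_of_mul h
    have h2 := nonneg_of_cubicTerm_ne_zero (left_ne_zero_of_mul (left_ne_zero_of_mul h1))
    exact ⟨nonneg_of_qPochRecip_ne_zero (right_ne_zero_of_mul (left_ne_zero_of_mul h1)), h2.1,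
      h2.2.1, h2.2.2, nonneg_of_qPochRecip_ne_zero (right_ne_zero_of_mul h1)⟩
  calc _ = ∑ m ∈ Icc (0 : ℤ) M, ∑ n ∈ Icc (0 : ℤ) M, ∑ b ∈ Icc (0 : ℤ) M, ∑ c ∈ Icc (0 : ℤ) M,
        f n m b c := by
        refine sum_congr rfl fun m hm => sum_congr rfl fun n _ => ?_
        rw [mem_Icc] at hm
        lift m to ℕ using hm.1
        rw [← sum_cubicTerm hq0 hq M m hm.2]
        simp only [hf, ← mul_sum, ← sum_mul]
    _ = ∑ n ∈ Icc (0 : ℤ) M, ∑ m ∈ Icc (0 : ℤ) M, ∑ b ∈ Icc (0 : ℤ) M, ∑ c ∈ Icc (0 : ℤ) M,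
        f n m (b - n) (c - n) := by
        rw [sum_comm]
        refine sum_congr rfl fun n _ => sum_congr rfl fun m _ => ?_
        -- Nonzero terms have b, c ≤ m ≤ M - 2n, so the shifted indices b + n, c + n stay in the
        -- box.
        rw [← sum_add_of_support (Icc (0 : ℤ) M) (Icc (0 : ℤ) M) (-n)]
        · refine sum_congr rfl fun b _ => ?_
          rw [← sum_add_of_support (Icc (0 : ℤ) M) (Icc (0 : ℤ) M) (-n)]
          · rfl
          · intro c h
            have := hsupp _ _ _ _ h
            simp only [mem_Icc]
            lia
        · intro b h
          obtain ⟨c, -, h⟩ := exists_ne_zero_of_sum_ne_zero h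
          have := hsupp _ _ _ _ h
          simp only [mem_Icc]
          lia
    _ = ∑ n ∈ Icc (0 : ℤ) M, ∑ b ∈ Icc (0 : ℤ) M, ∑ c ∈ Icc (0 : ℤ) M, ∑ l ∈ Icc (0 : ℤ) M,
        f n (l + (b + c - 2 * n)) (b - n) (c - n) := by
        refine sum_congr rfl fun n _ => ?_
        rw [sum_comm]
        refine sum_congr rfl fun b _ => ?_
        rw [sum_comm]
        refine sum_congr rfl fun c _ => ?_
        symm
        refine sum_add_of_support (Icc (0 : ℤ) M) (Icc (0 : ℤ) M) (b + c - 2 * n)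
          (fun m => f n m (b - n) (c - n)) fun m h => ?_
        have := hsupp _ _ _ _ h
        simp only [mem_Icc]
        lia
    _ = ∑ l ∈ Icc (0 : ℤ) M, ∑ b ∈ Icc (0 : ℤ) M, ∑ c ∈ Icc (0 : ℤ) M, ∑ n ∈ Icc (0 : ℤ) M,
        f n (l + (b + c - 2 * n)) (b - n) (c - n) := by
        simp only [← sum_product']
        refine sum_nbij' (fun x => (x.2.2.2, x.2.1, x.2.2.1, x.1))
          (fun x => (x.2.2.2, x.2.1, x.2.2.1, x.1)) ?_ ?_ ?_ ?_ ?_ <;> simp <;> tauto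
    _ = _ := by
        refine sum_congr rfl fun l _ => sum_congr rfl fun b hb => sum_congr rfl fun c _ => ?_
        rw [mem_Icc] at hb
        lift b to ℕ using hb.1
        rw [mul_assoc (qPochRecip (q ^ 3) b * qPochRecip (q ^ 3) c),
          ← sum_zpow_mul_qPochRecip_three hp0 hp M b hb.2 c, sum_mul, mul_sum]
        refine sum_congr rfl fun n _ => ?_
        simp only [hf, cubicTerm]
        rw [show l + (b + c - 2 * n) - (b - n) - (c - n) = l by ring,
          show (M : ℤ) - 2 * n - (l + (b + c - 2 * n)) = M - l - b - c by ring, zpow_pow_three]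
        have h : q ^ (3 * (l ^ 2 + l * b + l * c + b ^ 2 + c ^ 2) + b - c) *
            q ^ (3 * ((b - n) * (c - n))) =
            q ^ (2 * (l + (b + c - 2 * n)) ^ 2 + 6 * (l + (b + c - 2 * n)) * n + 6 * n ^ 2) *
            q ^ (l ^ 2 + (b - n) ^ 2 + (c - n) ^ 2 - l * (b - n) - l * (c - n) -
              (b - n) * (c - n) + (b - n) - (c - n)) := by
          rw [← zpow_add₀ hq0, ← zpow_add₀ hq0]; congr 1; ring
        linear_combination (-qPochRecip (q ^ 3) n * qPochRecip (q ^ 3) (b - n) *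
          qPochRecip (q ^ 3) (c - n) * qPochRecip (q ^ 3) l *
          qPochRecip (q ^ 3) (M - l - b - c)) * h

theorem sum_qPochRecip_four_reduce {q : K} (hq0 : q ≠ 0) (hq : ∀ k : ℕ, 0 < k → q ^ k ≠ 1)
    (M : ℕ) :
    ∑ l ∈ Icc (0 : ℤ) M, ∑ b ∈ Icc (0 : ℤ) M, ∑ c ∈ Icc (0 : ℤ) M,
      q ^ (3 * (l ^ 2 + l * b + l * c + b ^ 2 + c ^ 2) + b - c) *
      (qPochRecip (q ^ 3) b * qPochRecip (q ^ 3) c * qPochRecip (q ^ 3) l *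
        qPochRecip (q ^ 3) (M - l - b - c)) =
    ∑ v ∈ Icc (0 : ℤ) M, ∑ u ∈ Icc (0 : ℤ) M,
      q ^ (3 * (u ^ 2 + v ^ 2 - u * v) + u - v) * (qPochRecip (q ^ 3) u *
        qPochRecip (q ^ 3) (M - u) * qPoch (q ^ 3) (q ^ 3) M *
          (qPochRecip (q ^ 3) v * qPochRecip (q ^ 3) (M - v))) := by
  have hp0 : q ^ 3 ≠ 0 := pow_ne_zero 3 hq0
  have hp := pow_three_pow_ne_one hq
  set f : ℤ → ℤ → ℤ → K := fun l b c =>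
      q ^ (3 * (l ^ 2 + l * b + l * c + b ^ 2 + c ^ 2) + b - c) *
      (qPochRecip (q ^ 3) b * qPochRecip (q ^ 3) c * qPochRecip (q ^ 3) l *
        qPochRecip (q ^ 3) (M - l - b - c)) with hf
  have hsupp : ∀ l b c, f l b c ≠ 0 → 0 ≤ l ∧ 0 ≤ b ∧ 0 ≤ c ∧ 0 ≤ M - l - b - c := by
    intro l b c h
    have h1 := right_ne_zero_of_mul h
    have h2 := left_ne_zero_of_mul h1
    have h3 := left_ne_zero_of_mul h2
    exact ⟨nonneg_of_qPochRecip_ne_zero (right_ne_zero_of_mul h2),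
      nonneg_of_qPochRecip_ne_zero (left_ne_zero_of_mul h3),
      nonneg_of_qPochRecip_ne_zero (right_ne_zero_of_mul h3),
      nonneg_of_qPochRecip_ne_zero (right_ne_zero_of_mul h1)⟩
  calc _ = ∑ l ∈ Icc (0 : ℤ) M, ∑ u ∈ Icc (0 : ℤ) M, ∑ v ∈ Icc (0 : ℤ) M,
        f l (u - l) (v - l) := by
        refine sum_congr rfl fun l _ => ?_
        rw [← sum_add_of_support (Icc (0 : ℤ) M) (Icc (0 : ℤ) M) (-l)]
        · refine sum_congr rfl fun b _ => ?_
          rw [← sum_add_of_support (Icc (0 : ℤ) M) (Icc (0 : ℤ) M) (-l)]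
          · rfl
          · intro c h
            have := hsupp _ _ _ h
            simp only [mem_Icc]
            lia
        · intro b h
          obtain ⟨c, -, h⟩ := exists_ne_zero_of_sum_ne_zero h
          have := hsupp _ _ _ h
          simp only [mem_Icc]
          lia
    _ = ∑ v ∈ Icc (0 : ℤ) M, ∑ u ∈ Icc (0 : ℤ) M, ∑ l ∈ Icc (0 : ℤ) M,
        f l (u - l) (v - l) := by
        simp only [← sum_product']
        refine sum_nbij' (fun x => (x.2.2, x.2.1, x.1)) (fun x => (x.2.2, x.2.1, x.1))
          ?_ ?_ ?_ ?_ ?_ <;> simp <;> tauto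
    _ = _ := by
        refine sum_congr rfl fun v _ => sum_congr rfl fun u hu => ?_
        rw [mem_Icc] at hu
        lift u to ℕ using hu.1
        -- With w = M - u, the Pochhammer factor of the summation is (q³;q³)_M for every u.
        obtain ⟨w, rfl⟩ := Nat.exists_eq_add_of_le (Int.ofNat_le.1 hu.2)
        have h4 := sum_zpow_mul_qPochRecip_four hp0 hp ((u + w : ℕ) : ℤ) u w hu.2 v
        rw [show (((u + w : ℕ) : ℤ) - u) = w by push_cast; ring,
          show (((u + w : ℕ) : ℤ) - v) = u + w - v by push_cast; ring, ← h4, mul_sum]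
        refine sum_congr rfl fun l _ => ?_
        simp only [hf]
        rw [zpow_pow_three, ← mul_assoc (q ^ _) (q ^ _), ← zpow_add₀ hq0,
          show ((u + w : ℕ) : ℤ) - l - (u - l) - (v - l) = w - v + l by push_cast; ring,
          show 3 * (l ^ 2 + l * (u - l) + l * (v - l) + (u - l) ^ 2 + (v - l) ^ 2) + (u - l) -
            (v - l) = 3 * ((u : ℤ) ^ 2 + v ^ 2 - u * v) + u - v + 3 * ((u - l) * (v - l)) by ring]
        ring

theorem sum_sum_eq_sum_qBinom {q : K} (hq0 : q ≠ 0) (hq : ∀ k : ℕ, 0 < k → q ^ k ≠ 1)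
    (M : ℕ) :
    qPoch (q ^ 3) (q ^ 3) M * ∑ v ∈ Icc (0 : ℤ) M, ∑ u ∈ Icc (0 : ℤ) M,
      q ^ (3 * (u ^ 2 + v ^ 2 - u * v) + u - v) * (qPochRecip (q ^ 3) u *
        qPochRecip (q ^ 3) (M - u) * qPoch (q ^ 3) (q ^ 3) M *
          (qPochRecip (q ^ 3) v * qPochRecip (q ^ 3) (M - v))) =
    ∑ j ∈ Icc (-(M : ℤ)) M, q ^ (3 * j ^ 2 + j) * qBinom (q ^ 3) (2 * M) (M + j) := by
  have hp0 : q ^ 3 ≠ 0 := pow_ne_zero 3 hq0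
  have hp := pow_three_pow_ne_one hq
  set g : ℤ → ℤ → K := fun u v => q ^ (3 * (u ^ 2 + v ^ 2 - u * v) + u - v) *
      (qPochRecip (q ^ 3) u * qPochRecip (q ^ 3) (M - u) * qPoch (q ^ 3) (q ^ 3) M *
          (qPochRecip (q ^ 3) v * qPochRecip (q ^ 3) (M - v))) with hg
  have hu : ∀ v ∈ Icc (0 : ℤ) M, ∑ u ∈ Icc (0 : ℤ) M, g u v =
      ∑ j ∈ Icc (-(M : ℤ)) M, g (j + v) v := by
    intro v hv
    rw [mem_Icc] at hv
    symm
    refine sum_add_of_support _ _ v (fun u => g u v) fun u h => ?_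
    have h1 := left_ne_zero_of_mul (left_ne_zero_of_mul (right_ne_zero_of_mul h))
    have h2 := nonneg_of_qPochRecip_ne_zero (left_ne_zero_of_mul h1)
    have h3 := nonneg_of_qPochRecip_ne_zero (right_ne_zero_of_mul h1)
    simp only [mem_Icc]
    lia
  rw [sum_congr rfl hu, sum_comm, mul_sum]
  refine sum_congr rfl fun j hj => ?_
  rw [mem_Icc] at hj
  have hM := qPoch_ne_zero hp M
  have h4 := sum_zpow_mul_qPochRecip_four hp0 hp M M M le_rfl (M + j)
  have hbinom : qBinom (q ^ 3) (2 * M) (M + j) = qPoch (q ^ 3) (q ^ 3) (M + M) *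
      (qPochRecip (q ^ 3) (M + j) * qPochRecip (q ^ 3) (M + M - (M + j))) := by
    have h1 : 0 ≤ (M : ℤ) + j := by lia
    have h2 : 0 ≤ 2 * (M : ℤ) - (M + j) := by lia
    rw [qBinom, if_pos ⟨h1, h2⟩, qPochRecip, if_pos h1, ← two_mul (M : ℤ), qPochRecip, if_pos h2,
      show (2 * (M : ℤ)).toNat = M + M by lia]
    field_simp
  have hR : qPochRecip (q ^ 3) M * qPoch (q ^ 3) (q ^ 3) M = 1 := by
    rw [qPochRecip_natCast, inv_mul_cancel₀ hM]
  have hsum : ∑ x ∈ Icc (0 : ℤ) M, g (j + x) x =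
      q ^ (3 * j ^ 2 + j) * qPoch (q ^ 3) (q ^ 3) M *
        (qPochRecip (q ^ 3) M * qPochRecip (q ^ 3) M * qPoch (q ^ 3) (q ^ 3) (M + M) *
        (qPochRecip (q ^ 3) (M + j) * qPochRecip (q ^ 3) (M + M - (M + j)))) := by
    -- The reflection x ↦ M - x brings the exponent to the Chu–Vandermonde form (M - x)(M + j - x).
    rw [← h4, ← sum_sub_left_of_support (Icc (0 : ℤ) M) (Icc (0 : ℤ) M) M, mul_sum]
    · refine sum_congr rfl fun x _ => ?_
      simp only [hg]
      rw [zpow_pow_three, show 3 * ((j + (M - x)) ^ 2 + (M - x) ^ 2 - (j + (M - x)) * (M - x)) +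
          (j + (M - x)) - (M - x) = 3 * j ^ 2 + j + 3 * ((M - x) * (M + j - x)) by ring,
        zpow_add₀ hq0, show (M : ℤ) - (M - x) = x by ring, show j + (M - x) = M + j - x by ring,
        show (M : ℤ) - (M + j - x) = M - (M + j) + x by ring]
      ring
    · intro l h
      have h1 := right_ne_zero_of_mul (right_ne_zero_of_mul h)
      have h2 := nonneg_of_qPochRecip_ne_zero (left_ne_zero_of_mul h1)
      have h3 := nonneg_of_qPochRecip_ne_zero (right_ne_zero_of_mul h1)
      simp only [mem_Icc]
      lia
  rw [hbinom, hsum]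
  generalize qPoch (q ^ 3) (q ^ 3) M = P at hR ⊢
  generalize qPochRecip (q ^ 3) (M : ℤ) = R at hR ⊢
  -- Uses (RP)² - 1 = (RP + 1)(RP - 1).
  linear_combination (q ^ (3 * j ^ 2 + j) * (qPoch (q ^ 3) (q ^ 3) (M + M) *
    (qPochRecip (q ^ 3) (M + j) * qPochRecip (q ^ 3) (M + M - (M + j)))) * (R * P + 1)) * hR

/-! ### Finite support, and the case q = 0 -/

theorem support_summand_subset (q : K) (M : ℕ) :
    (Function.support fun p : ℕ × ℕ => summand q M p.1 p.2) ⊆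
      (range (M + 1) ×ˢ range (M + 1) : Finset (ℕ × ℕ)) := by
  rintro ⟨m, n⟩ h
  have := nonneg_of_qPochRecip_ne_zero (right_ne_zero_of_mul (right_ne_zero_of_mul h))
  simp only [coe_product, Set.mem_prod, SetLike.mem_coe, mem_range]
  lia

theorem sum_range_natCast (M : ℕ) (f : ℤ → K) :
    ∑ m ∈ range (M + 1), f m = ∑ m ∈ Icc (0 : ℤ) M, f m := by
  refine sum_nbij' (fun m => (m : ℤ)) Int.toNat ?_ ?_ ?_ ?_ ?_ <;> simp; lia

theorem finsum_summand (q : K) (M : ℕ) :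
    ∑ᶠ p : ℕ × ℕ, summand q M p.1 p.2 = qPoch (q ^ 3) (q ^ 3) M *
      ∑ m ∈ Icc (0 : ℤ) M, ∑ n ∈ Icc (0 : ℤ) M, q ^ (2 * m ^ 2 + 6 * m * n + 6 * n ^ 2) *
        (qPochRecip q m * qPochRecip (q ^ 3) n * qPochRecip (q ^ 3) (M - 2 * n - m)) := by
  rw [finsum_eq_sum_of_support_subset _ (support_summand_subset q M),
    sum_product (f := fun p : ℕ × ℕ => summand q M p.1 p.2)]
  simp only [← sum_range_natCast, mul_sum]
  refine sum_congr rfl fun m _ => sum_congr rfl fun n _ => ?_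
  rw [summand, Q, ← zpow_natCast]
  push_cast
  ring

theorem finsum_summand_zero (M : ℕ) :
    ∑ᶠ p : ℕ × ℕ, summand (0 : K) M p.1 p.2 = 1 := by
  have hP : ∀ n, qPoch (0 : K) 0 n = 1 := fun n => by simp [qPoch]
  rw [finsum_eq_single _ (0, 0)]
  · simp [summand, Q, qPochRecip, hP]
  · rintro ⟨m, n⟩ h
    have hQ : Q m n ≠ 0 := by
      intro h0
      simp only [Q] at h0
      simp at h0
      simp_all
    simp [summand, hQ]

theorem sum_qBinom_zero (M : ℕ) :
    ∑ j ∈ Icc (-(M : ℤ)) M, (0 : K) ^ (3 * j ^ 2 + j) * qBinom (0 ^ 3) (2 * M) (M + j) = 1 := by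
  have hP : ∀ n, qPoch (0 : K) 0 n = 1 := fun n => by simp [qPoch]
  rw [sum_eq_single 0]
  · rw [qBinom, if_pos (by lia)]
    simp [hP]
  · intro j _ hj
    have h : 3 * j ^ 2 + j ≠ 0 := by
      rw [show 3 * j ^ 2 + j = j * (3 * j + 1) by ring]
      exact mul_ne_zero hj (by lia)
    rw [zero_zpow _ h, zero_mul]
  · intro h
    exact absurd (mem_Icc.2 (by lia)) h

end FinCap

theorem mainTheorem5 {K : Type*} [Field K] (q : K) (hq : ∀ k : ℕ, 0 < k → q ^ k ≠ 1) (M : ℕ) :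
    (Function.support fun p : ℕ × ℕ => FinCap.summand q M p.1 p.2).Finite ∧
      ∑ᶠ p : ℕ × ℕ, FinCap.summand q M p.1 p.2 =
        ∑ j ∈ Finset.Icc (-(M : ℤ)) (M : ℤ),
          q ^ (3 * j ^ 2 + j) * FinCap.qBinom (q ^ 3) (2 * (M : ℤ)) ((M : ℤ) + j) := by
  refine ⟨(Finset.finite_toSet _).subset (FinCap.support_summand_subset q M), ?_⟩
  rcases eq_or_ne q 0 with rfl | hq0
  · rw [FinCap.finsum_summand_zero, FinCap.sum_qBinom_zero]
  · rw [FinCap.finsum_summand, FinCap.sum_qPochRecip_two_reduce hq0 hq,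
      FinCap.sum_qPochRecip_four_reduce hq0 hq, FinCap.sum_sum_eq_sum_qBinom hq0 hq]
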